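/- Let $d\in\mathbb N$. For an open set $\Omega\subset\mathbb R^d$ let $\mathcal G(\Omega)=\mathcal F(C^\infty(\Omega))/\mathcal N(C^\infty(\Omega))$ be the simplified Colombeau algebra: with $p_{K,l}(f)=\sup_{|\alpha|\le l,\,x\in K}|\partial^\alpha f(x)|$ for $K\subset\Omega$ compact and $l\in\mathbb N$, a net $(f_\varepsilon)_{\varepsilon\in(0,1]}$ of complex valued smooth functions on $\Omega$ lies in $\mathcal F(C^\infty(\Omega))$ if for all $K,l$ there is $q\in\mathbb N$ with $p_{K,l}(f_\varepsilon)=o(\varepsilon^{-q})$ as $\varepsilon\to0$, and in $\mathcal N(C^\infty(\Omega))$ if for all $K,l$ and all $p\in\mathbb N$ one has $p_{K,l}(f_\varepsilon)=o(\varepsilon^{p})$ as $\varepsilon\to 0$. Let $\rho\in\mathcal S(\mathbb R^d)$ be even with $\int\rho=1$ and $\int x^m\rho(x)\,dx=0$ for all $m\in\mathbb N^d\setminus\{0\}$, and put $\rho_\varepsilon(x)=\varepsilon^{-d}\rho(x/\varepsilon)$ for $\varepsilon\in(0,1]$. Let $\chi\in\mathcal D(\mathbb R^d)$ with $0\le\chi\le1$,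 $\chi=1$ on $\overline{B(0,1)}$ and $\chi=0$ outside $B(0,2)$, and put $\theta_\varepsilon(x)=\rho_\varepsilon(x)\,\chi(x|\ln\varepsilon|)$ for $\varepsilon\in(0,1)$. Let $(\Omega_\lambda)_{\lambda\in\Lambda}$ be a locally finite covering of $\mathbb R^d$ by relatively compact open sets, and let $\psi_\lambda\in\mathcal D(\mathbb R^d)$ with $0\le\psi_\lambda\le1$ and $\psi_\lambda=1$ on a neighbourhood of $\overline{\Omega_\lambda}$. Then $(S*\rho_\varepsilon)_\varepsilon\in\mathcal F(C^\infty(\mathbb R^d))$ for every $S\in\mathcal E'(\mathbb R^d)$ and $(T*\theta_\varepsilon)_\varepsilon\in\mathcal F(C^\infty(\mathbb R^d))$ for every $T\in\mathcal D'(\mathbb R^d)$ (the value of the latter net at $\varepsilon=1$ is irrelevant and is set to $0$), so that the maps $$\iota_0:\mathcal E'(\mathbb R^d)\to\mathcal G(\mathbb R^d),\quad S\mapsto (S*\rho_\varepsilon)_\varepsilon+\mathcal N(C^\infty(\mathbb R^d)),\qquad \iota_S:\mathcal D'(\mathbb R^d)\to\mathcal G(\mathbb R^d),\quad T\mapsto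 (T*\theta_\varepsilon)_\varepsilon+\mathcal N(C^\infty(\mathbb R^d))$$ are well defined; there is exactly one map $\iota_A:\mathcal D'(\mathbb R^d)\to\mathcal G(\mathbb R^d)$ such that $\iota_A(T)|_{\Omega_\lambda}=\iota_0(\psi_\lambda T)|_{\Omega_\lambda}$ for all $\lambda\in\Lambda$ and all $T\in\mathcal D'(\mathbb R^d)$; and $\iota_A=\iota_S$. -/

import Mathlib

open Filter Topology Set MeasureTheory TopologicalSpace Asymptotics
open scoped ContDiff Distributions SchwartzMap

namespace Colombeau

/-- The Euclidean space `ℝ^d`. -/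
abbrev Sp (d : ℕ) : Type := EuclideanSpace ℝ (Fin d)

/-- The index set `(0,1]` of the nets. -/
abbrev Idx : Type := Set.Ioc (0 : ℝ) 1

/-- The filter `ε → 0` on `(0,1]`. -/
def toZero : Filter Idx := Filter.comap (fun ε : Idx => (ε : ℝ)) (𝓝 0)

variable {d : ℕ}

/-! ### Smooth functions on an open set and their seminorms -/

/-- Extension by zero to `ℝ^d` of a function on an open set `Ω`; it only serves to speak of the
derivatives at points of `Ω`. -/
noncomputable def ext {Ω : Opens (Sp d)} (f : Ω → ℂ) : Sp d → ℂ :=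
  Function.extend Subtype.val f 0

theorem ext_apply {Ω : Opens (Sp d)} (f : Ω → ℂ) {x : Sp d} (hx : x ∈ Ω) :
    ext f x = f ⟨x, hx⟩ :=
  Subtype.val_injective.extend_apply f 0 ⟨x, hx⟩

theorem ext_add {Ω : Opens (Sp d)} (f g : Ω → ℂ) : ext (f + g) = ext f + ext g := by
  have := Function.extend_add (Subtype.val : Ω → Sp d) f g 0 0
  simpa [ext] using this

theorem ext_mul {Ω : Opens (Sp d)} (f g : Ω → ℂ) : ext (f * g) = ext f * ext g := by
  have := Function.extend_mul (Subtype.val : Ω → Sp d) f g 0 0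
  simpa [ext] using this

/-- The smooth functions on the open set `Ω`, as a subalgebra of the algebra of all complex valued
functions on `Ω`. -/
noncomputable def smoothSubalgebra (Ω : Opens (Sp d)) : Subalgebra ℂ (Ω → ℂ) where
  carrier := {f | ContDiffOn ℝ ∞ (ext f) Ω}
  mul_mem' := by
    intro f g hf hg
    change ContDiffOn ℝ ∞ (ext (f * g)) Ω
    rw [ext_mul]
    exact ContDiffOn.mul hf hg
  add_mem' := by
    intro f g hf hg
    change ContDiffOn ℝ ∞ (ext (f + g)) Ω
    rw [ext_add]
    exact ContDiffOn.add hf hg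
  algebraMap_mem' := by
    intro c
    refine (contDiffOn_const (c := c)).congr ?_
    intro x hx
    rw [ext_apply _ hx]
    rfl

/-- The algebra `C^∞(Ω)` of complex valued smooth functions on the open set `Ω`. -/
def Smooth (Ω : Opens (Sp d)) : Type := smoothSubalgebra Ω

noncomputable instance (Ω : Opens (Sp d)) : CommRing (Smooth Ω) :=
  inferInstanceAs (CommRing (smoothSubalgebra Ω))

noncomputable instance (Ω : Opens (Sp d)) : Algebra ℂ (Smooth Ω) :=
  inferInstanceAs (Algebra ℂ (smoothSubalgebra Ω))

theorem Smooth.contDiffOn {Ω : Opens (Sp d)} (f : Smooth Ω) : ContDiffOn ℝ ∞ (ext f.1) Ω := f.2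

/-- The restriction to `Ω` of a smooth function on `ℝ^d`. -/
noncomputable def Smooth.of (Ω : Opens (Sp d)) (f : Sp d → ℂ) (hf : ContDiff ℝ ∞ f) : Smooth Ω :=
  ⟨fun x => f x, hf.contDiffOn.congr fun _ hx => ext_apply _ hx⟩

/-- The seminorm `p_{K,l}(f) = sup_{k ≤ l, x ∈ K} |D^k f(x)|`, for a compact set `K ⊆ Ω`.
The norm of the `k`-th differential is equivalent to the maximum of the `|∂^α f(x)|`, `|α| = k`. -/
noncomputable def seminorm {Ω : Opens (Sp d)} (K : Set (Sp d)) (l : ℕ) (f : Smooth Ω) : ℝ :=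
  sSup {r : ℝ | ∃ k ≤ l, ∃ x ∈ K, r = ‖iteratedFDeriv ℝ k (ext f.1) x‖}

section SeminormFacts

variable {Ω : Opens (Sp d)} {K : Set (Sp d)} {l : ℕ}

theorem seminorm_nonneg (f : Smooth Ω) : 0 ≤ seminorm K l f := by
  refine Real.sSup_nonneg ?_
  rintro r ⟨k, _, x, _, rfl⟩
  exact norm_nonneg _

theorem seminorm_le {f : Smooth Ω} {C : ℝ} (hC : 0 ≤ C)
    (h : ∀ k ≤ l, ∀ x ∈ K, ‖iteratedFDeriv ℝ k (ext f.1) x‖ ≤ C) : seminorm K l f ≤ C := by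
  refine Real.sSup_le ?_ hC
  rintro r ⟨k, hk, x, hx, rfl⟩
  exact h k hk x hx

theorem le_seminorm (hK : IsCompact K) (hKΩ : K ⊆ Ω) (f : Smooth Ω) {k : ℕ} (hk : k ≤ l)
    {x : Sp d} (hx : x ∈ K) : ‖iteratedFDeriv ℝ k (ext f.1) x‖ ≤ seminorm K l f := by
  refine le_csSup ?_ ⟨k, hk, x, hx, rfl⟩
  have hb : ∀ j : ℕ, ∃ C, ∀ x ∈ K, ‖iteratedFDeriv ℝ j (ext f.1) x‖ ≤ C := by
    intro j
    have hc : ContinuousOn (iteratedFDeriv ℝ j (ext f.1)) Ω := by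
      refine (f.contDiffOn.continuousOn_iteratedFDerivWithin (m := j) (mod_cast le_top)
        Ω.isOpen.uniqueDiffOn).congr ?_
      intro x hx
      exact (iteratedFDerivWithin_of_isOpen j Ω.isOpen hx).symm
    exact hK.exists_bound_of_continuousOn (hc.mono hKΩ)
  choose C hC using hb
  refine ⟨∑ j ∈ Finset.range (l + 1), |C j|, ?_⟩
  rintro r ⟨j, hj, y, hy, rfl⟩
  refine ((hC j y hy).trans (le_abs_self _)).trans ?_
  exact Finset.single_le_sum (f := fun j => |C j|) (fun _ _ => abs_nonneg _)
    (Finset.mem_range.2 (Nat.lt_succ_of_le hj))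

theorem seminorm_add_le (hK : IsCompact K) (hKΩ : K ⊆ Ω) (f g : Smooth Ω) :
    seminorm K l (f + g) ≤ seminorm K l f + seminorm K l g := by
  refine seminorm_le (add_nonneg (seminorm_nonneg f) (seminorm_nonneg g)) ?_
  intro k hk x hx
  have e : ext (f + g).1 = ext f.1 + ext g.1 := ext_add _ _
  have hf : ContDiffAt ℝ k (ext f.1) x :=
    ((f.contDiffOn.contDiffAt (Ω.isOpen.mem_nhds (hKΩ hx))).of_le (mod_cast le_top))
  have hg : ContDiffAt ℝ k (ext g.1) x :=
    ((g.contDiffOn.contDiffAt (Ω.isOpen.mem_nhds (hKΩ hx))).of_le (mod_cast le_top))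
  rw [e, iteratedFDeriv_add_apply hf hg]
  exact (norm_add_le _ _).trans
    (add_le_add (le_seminorm hK hKΩ f hk hx) (le_seminorm hK hKΩ g hk hx))

theorem norm_iteratedFDeriv_mul_le_of_mem (f g : Smooth Ω) {x : Sp d} (hx : x ∈ Ω) (k : ℕ) :
    ‖iteratedFDeriv ℝ k (ext (f * g).1) x‖ ≤ ∑ i ∈ Finset.range (k + 1), (k.choose i : ℝ) *
      ‖iteratedFDeriv ℝ i (ext f.1) x‖ * ‖iteratedFDeriv ℝ (k - i) (ext g.1) x‖ := by
  have e : ext (f * g).1 = fun y => ext f.1 y * ext g.1 y := ext_mul _ _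
  have := norm_iteratedFDerivWithin_mul_le f.contDiffOn g.contDiffOn Ω.isOpen.uniqueDiffOn hx
    (n := k) (mod_cast le_top)
  simpa only [e, iteratedFDerivWithin_of_isOpen _ Ω.isOpen hx] using this

theorem seminorm_mul_le (hK : IsCompact K) (hKΩ : K ⊆ Ω) (f g : Smooth Ω) :
    seminorm K l (f * g) ≤ 2 ^ l * (seminorm K l f * seminorm K l g) := by
  have hf := seminorm_nonneg (K := K) (l := l) f
  have hg := seminorm_nonneg (K := K) (l := l) g
  refine seminorm_le (by positivity) ?_
  intro k hk x hx
  refine (norm_iteratedFDeriv_mul_le_of_mem f g (hKΩ hx) k).trans ?_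
  calc _ ≤ ∑ i ∈ Finset.range (k + 1), (k.choose i : ℝ) * (seminorm K l f * seminorm K l g) := by
        refine Finset.sum_le_sum fun i hi => ?_
        have hi' : i ≤ k := Nat.lt_succ_iff.1 (Finset.mem_range.1 hi)
        rw [mul_assoc]
        have h1 := le_seminorm hK hKΩ f (hi'.trans hk) hx
        have h2 := le_seminorm hK hKΩ g ((Nat.sub_le k i).trans hk) hx
        gcongr
    _ = 2 ^ k * (seminorm K l f * seminorm K l g) := by
        rw [← Finset.sum_mul]
        congr 1
        exact_mod_cast Nat.sum_range_choose k
    _ ≤ _ := by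
        gcongr
        norm_num

end SeminormFacts

/-! ### The Colombeau algebra `𝒢(Ω)` and its restriction maps -/

/-- The moderate nets, as a subalgebra of the algebra `C^∞(Ω)^{(0,1]}` of all nets. -/
noncomputable def moderateSubalgebra (Ω : Opens (Sp d)) : Subalgebra ℂ (Idx → Smooth Ω) where
  carrier := {f | ∀ (l : ℕ) (K : Set (Sp d)), IsCompact K → K ⊆ Ω → ∃ q : ℕ,
    (fun ε : Idx => seminorm K l (f ε)) =o[toZero] fun ε : Idx => (ε : ℝ) ^ (-(q : ℤ))}
  mul_mem' := by
    intro f g hf hg l K hK hKΩ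
    obtain ⟨q, hq⟩ := hf l K hK hKΩ
    obtain ⟨r, hr⟩ := hg l K hK hKΩ
    refine ⟨q + r, ?_⟩
    have h := ((hq.mul hr).const_mul_left (2 ^ l))
    refine IsBigO.trans_isLittleO (IsBigO.of_bound 1 (Eventually.of_forall fun ε => ?_))
      (h.congr_right fun ε => ?_)
    · have h1 := seminorm_mul_le (l := l) hK hKΩ (f ε) (g ε)
      rw [one_mul, Real.norm_of_nonneg (seminorm_nonneg _)]
      exact h1.trans (le_abs_self _)
    · have : (ε : ℝ) ≠ 0 := ε.2.1.ne'
      rw [← zpow_add₀ this]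
      push_cast
      ring_nf
  add_mem' := by
    intro f g hf hg l K hK hKΩ
    obtain ⟨q, hq⟩ := hf l K hK hKΩ
    obtain ⟨r, hr⟩ := hg l K hK hKΩ
    have key : ∀ a b : ℕ, a ≤ b → (fun ε : Idx => (ε : ℝ) ^ (-(a : ℤ))) =O[toZero]
        fun ε : Idx => (ε : ℝ) ^ (-(b : ℤ)) := by
      intro a b hab
      refine IsBigO.of_bound 1 (Eventually.of_forall fun ε => ?_)
      have h0 : (0 : ℝ) < ε := ε.2.1
      rw [one_mul, Real.norm_of_nonneg (by positivity), Real.norm_of_nonneg (by positivity)]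
      exact zpow_le_zpow_right_of_le_one₀ h0 ε.2.2 (by omega)
    refine ⟨q + r, ?_⟩
    have h := (hq.trans_isBigO (key q (q + r) (by omega))).add
      (hr.trans_isBigO (key r (q + r) (by omega)))
    refine IsBigO.trans_isLittleO (IsBigO.of_bound 1 (Eventually.of_forall fun ε => ?_)) h
    have h1 := seminorm_add_le (l := l) hK hKΩ (f ε) (g ε)
    rw [one_mul, Real.norm_of_nonneg (seminorm_nonneg _)]
    exact h1.trans (le_abs_self _)
  algebraMap_mem' := by
    intro c l K hK hKΩ
    refine ⟨1, ?_⟩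
    have h2 : Tendsto (fun ε : Idx => (ε : ℝ)) toZero (𝓝 0) := tendsto_comap
    have h3 : (fun _ : Idx => (1 : ℝ)) =o[toZero] fun ε : Idx => (ε : ℝ) ^ (-((1 : ℕ) : ℤ)) := by
      refine isLittleO_of_tendsto' (Eventually.of_forall fun ε h => ?_) (h2.congr fun ε => ?_)
      · exact absurd h (zpow_ne_zero _ ε.2.1.ne')
      · simp
    have h4 : (fun _ : Idx => seminorm K l (algebraMap ℂ (Smooth Ω) c)) =O[toZero]
        fun _ : Idx => (1 : ℝ) := isBigO_const_const _ one_ne_zero _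
    exact h4.trans_isLittleO h3

/-- The algebra `ℱ(C^∞(Ω))` of moderate nets. -/
def Moderate (Ω : Opens (Sp d)) : Type := moderateSubalgebra Ω

noncomputable instance (Ω : Opens (Sp d)) : CommRing (Moderate Ω) :=
  inferInstanceAs (CommRing (moderateSubalgebra Ω))

noncomputable instance (Ω : Opens (Sp d)) : Algebra ℂ (Moderate Ω) :=
  inferInstanceAs (Algebra ℂ (moderateSubalgebra Ω))

/-- The ideal `𝒩(C^∞(Ω))` of negligible nets. -/
noncomputable def Negligible (Ω : Opens (Sp d)) : Ideal (Moderate Ω) where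
  carrier := {f | ∀ (l : ℕ) (K : Set (Sp d)), IsCompact K → K ⊆ Ω → ∀ p : ℕ,
    (fun ε : Idx => seminorm K l (f.1 ε)) =o[toZero] fun ε : Idx => (ε : ℝ) ^ p}
  add_mem' := by
    intro f g hf hg l K hK hKΩ p
    refine IsBigO.trans_isLittleO (IsBigO.of_bound 1 (Eventually.of_forall fun ε => ?_))
      ((hf l K hK hKΩ p).add (hg l K hK hKΩ p))
    have h1 := seminorm_add_le (l := l) hK hKΩ (f.1 ε) (g.1 ε)
    rw [one_mul, Real.norm_of_nonneg (seminorm_nonneg _)]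
    exact h1.trans (le_abs_self _)
  zero_mem' := by
    intro l K hK hKΩ p
    have : ∀ ε : Idx, seminorm K l ((0 : Moderate Ω).1 ε) = 0 := by
      intro ε
      refine le_antisymm (seminorm_le le_rfl ?_) (seminorm_nonneg _)
      intro k _ x _
      have e : ext ((0 : Moderate Ω).1 ε).1 = 0 := by
        funext y
        by_cases hy : y ∈ Ω
        · rw [ext_apply _ hy]
          rfl
        · exact Function.extend_apply' _ _ _ (fun ⟨a, ha⟩ => hy (ha ▸ a.2))
      rw [e]
      simp
    simp only [this]
    exact isLittleO_zero _ _
  smul_mem' := by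
    intro c f hf l K hK hKΩ p
    obtain ⟨q, hq⟩ := c.2 l K hK hKΩ
    have h := ((hq.mul (hf l K hK hKΩ (p + q))).const_mul_left (2 ^ l))
    refine IsBigO.trans_isLittleO (IsBigO.of_bound 1 (Eventually.of_forall fun ε => ?_))
      (h.congr_right fun ε => ?_)
    · have h1 := seminorm_mul_le (l := l) hK hKΩ (c.1 ε) (f.1 ε)
      rw [one_mul, Real.norm_of_nonneg (seminorm_nonneg _)]
      exact h1.trans (le_abs_self _)
    · have : (ε : ℝ) ≠ 0 := ε.2.1.ne'
      rw [zpow_neg, zpow_natCast, pow_add]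
      field_simp

/-- The simplified Colombeau algebra `𝒢(Ω) = ℱ(C^∞(Ω)) / 𝒩(C^∞(Ω))`. -/
abbrev G (Ω : Opens (Sp d)) : Type := Moderate Ω ⧸ Negligible Ω

/-- Restriction `C^∞(Ω) → C^∞(Ω')` for `Ω' ⊆ Ω`. -/
noncomputable def Smooth.restrict {Ω Ω' : Opens (Sp d)} (h : Ω' ≤ Ω) (f : Smooth Ω) : Smooth Ω' :=
  ⟨fun x => f.1 ⟨x, h x.2⟩, (f.contDiffOn.mono h).congr fun x hx => by
    rw [ext_apply _ hx, ext_apply _ (h hx)]⟩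

theorem seminorm_restrict {Ω Ω' : Opens (Sp d)} (h : Ω' ≤ Ω) {K : Set (Sp d)} (hK : K ⊆ Ω')
    (l : ℕ) (f : Smooth Ω) : seminorm K l (f.restrict h) = seminorm K l f := by
  have key : ∀ k : ℕ, ∀ x ∈ K, iteratedFDeriv ℝ k (ext (f.restrict h).1) x =
      iteratedFDeriv ℝ k (ext f.1) x := by
    intro k x hx
    have : ext (f.restrict h).1 =ᶠ[𝓝 x] ext f.1 := by
      filter_upwards [Ω'.isOpen.mem_nhds (hK hx)] with y hy
      rw [ext_apply _ hy, ext_apply _ (h hy)]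
      rfl
    exact (this.iteratedFDeriv ℝ k).eq_of_nhds
  unfold seminorm
  congr 1
  ext r
  constructor
  · rintro ⟨k, hk, x, hx, rfl⟩
    exact ⟨k, hk, x, hx, by rw [key k x hx]⟩
  · rintro ⟨k, hk, x, hx, rfl⟩
    exact ⟨k, hk, x, hx, by rw [key k x hx]⟩

/-- Restriction of moderate nets. -/
noncomputable def Moderate.restrict {Ω Ω' : Opens (Sp d)} (h : Ω' ≤ Ω) :
    Moderate Ω →+* Moderate Ω' where
  toFun f := ⟨fun ε => (f.1 ε).restrict h, fun l K hK hKΩ => by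
    obtain ⟨q, hq⟩ := f.2 l K hK (hKΩ.trans h)
    exact ⟨q, by simpa only [seminorm_restrict h hKΩ] using hq⟩⟩
  map_one' := rfl
  map_mul' _ _ := rfl
  map_zero' := rfl
  map_add' _ _ := rfl

/-- The restriction map `𝒢(Ω) → 𝒢(Ω')`, `u ↦ u|_{Ω'}`, for `Ω' ⊆ Ω`. -/
noncomputable def G.restrict {Ω Ω' : Opens (Sp d)} (h : Ω' ≤ Ω) : G Ω →+* G Ω' :=
  Ideal.quotientMap (Negligible Ω') (Moderate.restrict h) fun f hf l K hK hKΩ p => by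
    have h1 := hf l K hK (hKΩ.trans h) p
    change (fun ε : Idx => seminorm K l ((f.1 ε).restrict h)) =o[toZero] fun ε : Idx => (ε : ℝ) ^ p
    simpa only [seminorm_restrict h hKΩ] using h1

/-- The net `(f_ε)` of functions on `ℝ^d` belongs to `ℱ(C^∞(ℝ^d))`. -/
def IsModerate (f : Idx → Sp d → ℂ) : Prop :=
  ∃ h : ∀ ε, ContDiff ℝ ∞ (f ε), (fun ε => Smooth.of ⊤ (f ε) (h ε)) ∈ moderateSubalgebra (⊤ : Opens (Sp d))

/-- The class `(f_ε) + 𝒩(C^∞(ℝ^d))` in `𝒢(ℝ^d)` of a net `(f_ε) ∈ ℱ(C^∞(ℝ^d))`. -/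
noncomputable def classOf (f : Idx → Sp d → ℂ) (h : IsModerate f) : G (⊤ : Opens (Sp d)) :=
  Ideal.Quotient.mk (Negligible ⊤) ⟨fun ε => Smooth.of ⊤ (f ε) (h.fst ε), h.snd⟩

/-! ### Distributions -/

/-- Complex valued test functions `𝒟(ℝ^d)`. -/
abbrev Test (d : ℕ) : Type := 𝓓((⊤ : Opens (Sp d)), ℂ)

/-- Distributions `𝒟'(ℝ^d)`: the continuous complex linear forms on `𝒟(ℝ^d)`. -/
abbrev Distr (d : ℕ) : Type := Test d →L[ℂ] ℂ

/-- The test function `x ↦ φ (y - x)`. -/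
noncomputable def Test.flip (φ : Test d) (y : Sp d) : Test d where
  toFun x := φ (y - x)
  contDiff' := φ.contDiff.comp (contDiff_const.sub contDiff_id)
  hasCompactSupport' := φ.hasCompactSupport.comp_homeomorph (Homeomorph.subLeft y)
  tsupport_subset' := fun _ _ => trivial

/-- The convolution `(T ∗ φ)(y) = ⟨T, x ↦ φ (y - x)⟩` of `T ∈ 𝒟'(ℝ^d)` with `φ ∈ 𝒟(ℝ^d)`. -/
noncomputable def Distr.conv (T : Distr d) (φ : Test d) (y : Sp d) : ℂ := T (φ.flip y)

/-- Compactly supported distributions `ℰ'(ℝ^d)`: the linear forms on `C^∞(ℝ^d)` that are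
continuous for the topology given by the (directed) family of seminorms `p_{K,l}`. -/
structure CDistr (d : ℕ) where
  /-- The linear form. -/
  toLin : Smooth (⊤ : Opens (Sp d)) →ₗ[ℂ] ℂ
  continuous' : ∃ (K : Set (Sp d)) (l : ℕ) (C : ℝ), IsCompact K ∧ ∀ f, ‖toLin f‖ ≤ C * seminorm K l f

/-- The smooth function `x ↦ f (y - x)`. -/
noncomputable def Smooth.flip (f : Sp d → ℂ) (hf : ContDiff ℝ ∞ f) (y : Sp d) :
    Smooth (⊤ : Opens (Sp d)) :=
  Smooth.of ⊤ (fun x => f (y - x)) (hf.comp (contDiff_const.sub contDiff_id))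

/-- The convolution `(S ∗ f)(y) = ⟨S, x ↦ f (y - x)⟩` of `S ∈ ℰ'(ℝ^d)` with `f ∈ C^∞(ℝ^d)`. -/
noncomputable def CDistr.conv (S : CDistr d) (f : Sp d → ℂ) (hf : ContDiff ℝ ∞ f) (y : Sp d) : ℂ :=
  S.toLin (Smooth.flip f hf y)

theorem Smooth.contDiff_ext (f : Smooth (⊤ : Opens (Sp d))) : ContDiff ℝ ∞ (ext f.1) := by
  have := f.contDiffOn
  rwa [Opens.coe_top, contDiffOn_univ] at this

/-- A real valued test function, as a complex valued smooth function. -/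
noncomputable def cutoff (ψ : 𝓓((⊤ : Opens (Sp d)), ℝ)) : Smooth (⊤ : Opens (Sp d)) :=
  Smooth.of ⊤ (fun x => (ψ x : ℂ)) (Complex.ofRealCLM.contDiff.comp ψ.contDiff)

theorem ext_cutoff_mul (ψ : 𝓓((⊤ : Opens (Sp d)), ℝ)) (f : Smooth (⊤ : Opens (Sp d))) :
    ext (cutoff ψ * f).1 = fun x => (ψ x : ℂ) * f.1 ⟨x, trivial⟩ := by
  funext x
  rw [ext_apply _ (show x ∈ (⊤ : Opens (Sp d)) from trivial)]
  rfl

/-- The test function `ψ f ∈ 𝒟(ℝ^d)`, for `ψ ∈ 𝒟(ℝ^d)` and `f ∈ C^∞(ℝ^d)`. -/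
noncomputable def mulTest (ψ : 𝓓((⊤ : Opens (Sp d)), ℝ)) (f : Smooth (⊤ : Opens (Sp d))) :
    Test d where
  toFun x := ψ x * f.1 ⟨x, trivial⟩
  contDiff' := by
    have h := (cutoff ψ * f).contDiff_ext
    exact ext_cutoff_mul ψ f ▸ h
  hasCompactSupport' := by
    refine HasCompactSupport.intro ψ.hasCompactSupport fun x hx => ?_
    have : ψ x = 0 := image_eq_zero_of_notMem_tsupport hx
    simp [this]
  tsupport_subset' := fun _ _ => trivial

/-- A distribution is bounded by finitely many derivatives on the test functions that are supported
in a fixed compact set. -/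
theorem Distr.exists_bound (T : Distr d) (K : Compacts (Sp d)) :
    ∃ (l : ℕ) (C : ℝ), 0 ≤ C ∧ ∀ φ : Test d, (∀ x ∉ K, φ x = 0) → ∀ M : ℝ, 0 ≤ M →
      (∀ k ≤ l, ∀ x, ‖iteratedFDeriv ℝ k φ x‖ ≤ M) → ‖T φ‖ ≤ C * M := by
  let L : 𝓓_{K}(Sp d, ℂ) →L[ℂ] ℂ :=
    T.comp (TestFunction.ofSupportedInCLM ℂ (fun _ _ => trivial))
  obtain ⟨s, C, _, hC⟩ := Seminorm.bound_of_continuous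
    (ContDiffMapSupportedIn.withSeminorms ℂ (Sp d) ℂ ⊤ K) ((normSeminorm ℂ ℂ).comp L.toLinearMap)
    L.continuous.norm
  refine ⟨s.sup id, C, C.2, fun φ hφ M hM hb => ?_⟩
  let φ' : 𝓓_{K}(Sp d, ℂ) := ⟨φ, φ.contDiff, fun x hx => hφ x hx⟩
  have h1 : ‖T φ‖ ≤ C * (s.sup (ContDiffMapSupportedIn.seminorm ℂ (Sp d) ℂ ⊤ K)) φ' := hC φ'
  refine h1.trans (mul_le_mul_of_nonneg_left ?_ C.2)
  refine Seminorm.finset_sup_apply_le hM fun k hk => ?_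
  rw [ContDiffMapSupportedIn.seminorm_top_le_iff ℂ hM]
  exact fun x _ => hb k (Finset.le_sup (f := id) hk) x

/-- The product `ψ T ∈ ℰ'(ℝ^d)` of `T ∈ 𝒟'(ℝ^d)` with `ψ ∈ 𝒟(ℝ^d)`: `⟨ψ T, f⟩ = ⟨T, ψ f⟩`. -/
noncomputable def Distr.cut (ψ : 𝓓((⊤ : Opens (Sp d)), ℝ)) (T : Distr d) : CDistr d where
  toLin :=
    { toFun := fun f => T (mulTest ψ f)
      map_add' := by
        intro f g
        rw [← map_add]
        congr 1
        ext x
        change (ψ x : ℂ) * (f.1 _ + g.1 _) = (ψ x : ℂ) * f.1 _ + (ψ x : ℂ) * g.1 _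
        ring
      map_smul' := by
        intro c f
        rw [RingHom.id_apply, ← map_smul]
        congr 1
        ext x
        change (ψ x : ℂ) * (c * f.1 _) = c * ((ψ x : ℂ) * f.1 _)
        ring }
  continuous' := by
    have hK : IsCompact (tsupport ψ) := ψ.hasCompactSupport
    obtain ⟨l, C, hC, hb⟩ := T.exists_bound ⟨tsupport ψ, hK⟩
    refine ⟨tsupport ψ, l, C * (2 ^ l * seminorm (tsupport ψ) l (cutoff ψ)), hK, fun f => ?_⟩
    have e : (mulTest ψ f : Sp d → ℂ) = ext (cutoff ψ * f).1 := (ext_cutoff_mul ψ f).symm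
    have hz : ∀ x ∉ tsupport ψ, mulTest ψ f x = 0 := by
      intro x hx
      change (ψ x : ℂ) * _ = 0
      rw [image_eq_zero_of_notMem_tsupport hx, Complex.ofReal_zero, zero_mul]
    have h1 := hb (mulTest ψ f) hz (seminorm (tsupport ψ) l (cutoff ψ * f)) (seminorm_nonneg _) (by
      intro k hk x
      by_cases hx : x ∈ tsupport ψ
      · rw [e]
        exact le_seminorm hK (Set.subset_univ _) _ hk hx
      · have h0 : (mulTest ψ f : Sp d → ℂ) =ᶠ[𝓝 x] fun _ => 0 := by
          filter_upwards [(isClosed_tsupport ψ).isOpen_compl.mem_nhds hx] with y hy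
          exact hz y hy
        rw [(h0.iteratedFDeriv ℝ k).eq_of_nhds, iteratedFDeriv_fun_zero]
        simpa using seminorm_nonneg _)
    refine h1.trans ?_
    rw [mul_assoc, mul_assoc]
    exact mul_le_mul_of_nonneg_left (seminorm_mul_le hK (Set.subset_univ _) _ _) hC

/-! ### The mollifiers -/

/-- The conditions on the mollifier `ρ ∈ 𝒮(ℝ^d)`: it is even, has integral one and all its moments
of positive order vanish. -/
structure IsMollifier (ρ : 𝓢(Sp d, ℂ)) : Prop where
  even : ∀ x, ρ (-x) = ρ x
  integral_eq_one : ∫ x, ρ x = 1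
  moment_eq_zero : ∀ m : Fin d → ℕ, m ≠ 0 → ∫ x : Sp d, ((∏ i, x i ^ m i : ℝ) : ℂ) * ρ x = 0

/-- The conditions on the cutoff `χ ∈ 𝒟(ℝ^d)`. -/
structure IsCutoff (χ : 𝓓((⊤ : Opens (Sp d)), ℝ)) : Prop where
  nonneg : ∀ x, 0 ≤ χ x
  le_one : ∀ x, χ x ≤ 1
  eq_one : ∀ x ∈ Metric.closedBall (0 : Sp d) 1, χ x = 1
  eq_zero : ∀ x ∉ Metric.ball (0 : Sp d) 2, χ x = 0

/-- `ρ_ε(x) = ε^{-d} ρ(x / ε)`. -/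
noncomputable def rhoEps (ρ : 𝓢(Sp d, ℂ)) (ε : Idx) (x : Sp d) : ℂ :=
  (((ε : ℝ) ^ d)⁻¹ : ℝ) * ρ ((ε : ℝ)⁻¹ • x)

theorem contDiff_rhoEps (ρ : 𝓢(Sp d, ℂ)) (ε : Idx) : ContDiff ℝ ∞ (rhoEps ρ ε) :=
  contDiff_const.mul ((ρ.smooth ⊤).comp (contDiff_const_smul _))

/-- `θ_ε(x) = ρ_ε(x) χ(x |ln ε|)`, a test function for `ε ∈ (0,1)`. -/
noncomputable def thetaEps (ρ : 𝓢(Sp d, ℂ)) (χ : 𝓓((⊤ : Opens (Sp d)), ℝ)) (ε : Idx)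
    (hε : (ε : ℝ) < 1) : Test d where
  toFun x := rhoEps ρ ε x * (χ (|Real.log ε| • x) : ℂ)
  contDiff' := (contDiff_rhoEps ρ ε).mul
    (Complex.ofRealCLM.contDiff.comp (χ.contDiff.comp (contDiff_const_smul _)))
  hasCompactSupport' := by
    have h0 : |Real.log ε| ≠ 0 := abs_ne_zero.2 (Real.log_neg ε.2.1 hε).ne
    have h1 : HasCompactSupport fun x : Sp d => χ (|Real.log ε| • x) :=
      χ.hasCompactSupport.comp_homeomorph (Homeomorph.smulOfNeZero _ h0)
    have h2 : HasCompactSupport fun x : Sp d => (χ (|Real.log ε| • x) : ℂ) :=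
      h1.comp_left (g := fun r : ℝ => (r : ℂ)) Complex.ofReal_zero
    exact h2.mul_left
  tsupport_subset' := fun _ _ => trivial

/-- The net `(S ∗ ρ_ε)`, for `S ∈ ℰ'(ℝ^d)`. -/
noncomputable def netZero (ρ : 𝓢(Sp d, ℂ)) (S : CDistr d) (ε : Idx) : Sp d → ℂ :=
  S.conv (rhoEps ρ ε) (contDiff_rhoEps ρ ε)

open Classical in
/-- The net `(T ∗ θ_ε)`, for `T ∈ 𝒟'(ℝ^d)`. A class in `𝒢(ℝ^d)` does not depend on the value of the
net at `ε = 1`, where the convolution makes no sense in general; this value is set to `0`. -/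
noncomputable def netS (ρ : 𝓢(Sp d, ℂ)) (χ : 𝓓((⊤ : Opens (Sp d)), ℝ)) (T : Distr d) (ε : Idx) :
    Sp d → ℂ :=
  if hε : (ε : ℝ) < 1 then T.conv (thetaEps ρ χ ε hε) else 0

/-! ### The embeddings -/

/-- `ι_0 : ℰ'(ℝ^d) → 𝒢(ℝ^d)`, `S ↦ (S ∗ ρ_ε) + 𝒩(C^∞(ℝ^d))`. -/
noncomputable def iotaZero (ρ : 𝓢(Sp d, ℂ)) (h : ∀ S, IsModerate (netZero ρ S)) (S : CDistr d) :
    G (⊤ : Opens (Sp d)) :=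
  classOf (netZero ρ S) (h S)

/-- `ι_S : 𝒟'(ℝ^d) → 𝒢(ℝ^d)`, `T ↦ (T ∗ θ_ε) + 𝒩(C^∞(ℝ^d))`. -/
noncomputable def iotaS (ρ : 𝓢(Sp d, ℂ)) (χ : 𝓓((⊤ : Opens (Sp d)), ℝ))
    (h : ∀ T, IsModerate (netS ρ χ T)) (T : Distr d) : G (⊤ : Opens (Sp d)) :=
  classOf (netS ρ χ T) (h T)

/-- The conditions on the covering `(Ω_i)` and the cutoffs `(ψ_i)` of the local construction. -/
structure IsCutoffCover {Λ : Type*} (Ω : Λ → Opens (Sp d)) (ψ : Λ → 𝓓((⊤ : Opens (Sp d)), ℝ)) :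
    Prop where
  cover : ⋃ i, (Ω i : Set (Sp d)) = Set.univ
  locallyFinite : LocallyFinite fun i => (Ω i : Set (Sp d))
  isCompact_closure : ∀ i, IsCompact (closure (Ω i : Set (Sp d)))
  nonneg : ∀ i x, 0 ≤ ψ i x
  le_one : ∀ i x, ψ i x ≤ 1
  eq_one : ∀ i, ∀ᶠ x in 𝓝ˢ (closure (Ω i : Set (Sp d))), ψ i x = 1

/-- `ι_i : 𝒟'(ℝ^d) → 𝒢(Ω_i)`, `T ↦ ι_0(ψ_i T)|_{Ω_i}`. -/
noncomputable def iotaLocal (ρ : 𝓢(Sp d, ℂ)) (h : ∀ S, IsModerate (netZero ρ S))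
    (Ωi : Opens (Sp d)) (ψi : 𝓓((⊤ : Opens (Sp d)), ℝ)) (T : Distr d) : G Ωi :=
  G.restrict le_top (iotaZero ρ h (T.cut ψi))

/-- `ι` is obtained by gluing together the local maps: `ι(T)|_{Ω_i} = ι_i(T)` for all `i`, `T`. -/
def IsGluing (ρ : 𝓢(Sp d, ℂ)) (h : ∀ S, IsModerate (netZero ρ S)) {Λ : Type*}
    (Ω : Λ → Opens (Sp d)) (ψ : Λ → 𝓓((⊤ : Opens (Sp d)), ℝ))
    (ι : Distr d → G (⊤ : Opens (Sp d))) : Prop :=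
  ∀ i T, G.restrict le_top (ι T) = iotaLocal ρ h (Ω i) (ψ i) T

end Colombeau

/-!
Near a point of `Ω_λ` and for small `ε`, the net `T ∗ θ_ε` equals `(ψ_λ T) ∗ θ_ε`, because the
support of `θ_ε` shrinks to the origin like `1 / |ln ε|`. It thus suffices to compare the
convolutions of the compactly supported distribution `ψ_λ T` with `ρ_ε` and `θ_ε`. Near the origin,
at the scale `1 / |ln ε|`, these mollifiers coincide; farther out `|x| / ε` is at least a multiple
of `1 / (ε |ln ε|)`, so the decay of `ρ` makes `ρ_ε` and its derivatives smaller than any power of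
`ε`. Convolution with `ψ_λ T` preserves such bounds, since it is controlled by finitely many
derivatives. Uniqueness holds because an element of `𝒢(ℝ^d)` is determined by its restrictions to
an open covering, every compact set being a finite union of compact subsets of its members.
-/

namespace Colombeau

section Calculus

universe u

variable {E F : Type*} [NormedAddCommGroup E] [NormedSpace ℝ E] [NormedAddCommGroup F]
  [NormedSpace ℝ F] {f : E → F}

theorem contDiff_fderiv_apply_const (hf : ContDiff ℝ ∞ f) (v : E) :
    ContDiff ℝ ∞ fun x => fderiv ℝ f x v :=
  (contDiff_infty_iff_fderiv.1 hf).2.clm_apply contDiff_const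

theorem norm_iteratedFDeriv_fderiv_apply_const_le {k : ℕ} (hf : ContDiff ℝ (k + 1) f) (v x : E) :
    ‖iteratedFDeriv ℝ k (fun y => fderiv ℝ f y v) x‖ ≤ ‖v‖ * ‖iteratedFDeriv ℝ (k + 1) f x‖ := by
  rw [← norm_iteratedFDeriv_fderiv]
  exact norm_iteratedFDeriv_clm_apply_const (hf.fderiv_right le_rfl).contDiffAt le_rfl

theorem iteratedFDeriv_succ_apply_eq_fderiv_apply_last {k : ℕ} (hf : ContDiff ℝ (k + 1) f) (x : E)
    (m : Fin (k + 1) → E) :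
    iteratedFDeriv ℝ (k + 1) f x m =
      iteratedFDeriv ℝ k (fun y => fderiv ℝ f y (m (Fin.last k))) x (Fin.init m) := by
  rw [iteratedFDeriv_succ_apply_right,
    ← iteratedFDeriv_clm_apply_const_apply (hf.fderiv_right le_rfl) le_rfl]

theorem fderiv_fderiv_apply_const (hf : ContDiff ℝ 2 f) (v : E) :
    fderiv ℝ (fun x => fderiv ℝ f x v) = fun x => fderiv ℝ (fderiv ℝ f) x v := by
  ext x w
  have hsymm : IsSymmSndFDerivAt ℝ f x :=
    hf.contDiffAt.isSymmSndFDerivAt (by rw [minSmoothness_of_isRCLikeNormedField])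
  have hdiff : DifferentiableAt ℝ (fderiv ℝ f) x :=
    (hf.fderiv_right (m := 1) (by norm_num)).differentiable one_ne_zero x
  rw [fderiv_clm_apply hdiff (differentiableAt_const v)]
  simpa using hsymm w v

theorem eventually_norm_remainder_le (hf : ContDiff ℝ 1 f) {K : Set E} (hK : IsCompact K) {c : ℝ}
    (hc : 0 < c) :
    ∀ᶠ h in 𝓝 (0 : E), ∀ x ∈ K, ‖f (x + h) - f x - fderiv ℝ f x h‖ ≤ c * ‖h‖ := by
  have hunif := hK.uniformContinuousAt_of_continuousAt (fderiv ℝ f)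
    (fun a _ => (hf.continuous_fderiv one_ne_zero).continuousAt) (Metric.dist_mem_uniformity hc)
  obtain ⟨δ, hδ, hclose⟩ := Metric.mem_uniformity_dist.1 hunif
  filter_upwards [Metric.ball_mem_nhds (0 : E) hδ] with h hh x hx
  have hbound : ∀ y ∈ Metric.ball x δ, ‖fderiv ℝ f y - fderiv ℝ f x‖ ≤ c := fun y hy => by
    rw [← dist_eq_norm, dist_comm]
    exact (hclose (by rwa [dist_comm]) hx).le
  simpa using (convex_ball x δ).norm_image_sub_le_of_norm_hasFDerivWithin_le'
    (fun y _ => (hf.differentiable one_ne_zero y).hasFDerivAt.hasFDerivWithinAt) hbound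
    (Metric.mem_ball_self hδ) (y := x + h) (by simpa using hh)

/- By the symmetry of second derivatives, differentiating the first order Taylor remainder of `f`
gives the one of `fderiv ℝ f`; so the case `k = 0`, applied to the derivatives of `f`, suffices. -/
theorem eventually_norm_iteratedFDeriv_remainder_le {E F : Type u} [NormedAddCommGroup E]
    [NormedSpace ℝ E] [NormedAddCommGroup F] [NormedSpace ℝ F] {f : E → F} {k : ℕ}
    (hf : ContDiff ℝ (k + 1) f) {K : Set E} (hK : IsCompact K) {c : ℝ} (hc : 0 < c) :
    ∀ᶠ h in 𝓝 (0 : E), ∀ x ∈ K,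
      ‖iteratedFDeriv ℝ k (fun y => f (y + h) - f y - fderiv ℝ f y h) x‖ ≤ c * ‖h‖ := by
  induction k generalizing F with
  | zero =>
    simpa only [norm_iteratedFDeriv_zero] using
      eventually_norm_remainder_le (by simpa using hf) hK hc
  | succ k ih =>
    have hfderiv : ContDiff ℝ (k + 1) (fderiv ℝ f) := hf.fderiv_right le_rfl
    have hdiff : Differentiable ℝ f := hf.differentiable (by simp)
    filter_upwards [ih hfderiv] with h hh x hx
    have hremainder : fderiv ℝ (fun y => f (y + h) - f y - fderiv ℝ f y h) =
        fun y => fderiv ℝ f (y + h) - fderiv ℝ f y - fderiv ℝ (fderiv ℝ f) y h := by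
      funext y
      have hshift : DifferentiableAt ℝ (fun z => f (z + h)) y :=
        (hdiff (y + h)).comp y (differentiableAt_id.add_const h)
      have hdir : DifferentiableAt ℝ (fun z => fderiv ℝ f z h) y :=
        (hfderiv.differentiable (by simp) y).clm_apply (differentiableAt_const h)
      rw [fderiv_fun_sub (hshift.fun_sub (hdiff y)) hdir, fderiv_fun_sub hshift (hdiff y),
        fderiv_comp_add_right, fderiv_fderiv_apply_const (hf.of_le (by norm_cast; omega))]
    rw [← norm_iteratedFDeriv_fderiv, hremainder]
    exact hh x hx

theorem norm_iteratedFDeriv_comp_sub_left (f : E → F) (y : E) (k : ℕ) (x : E) :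
    ‖iteratedFDeriv ℝ k (fun z => f (y - z)) x‖ = ‖iteratedFDeriv ℝ k f (y - x)‖ := by
  have h := (LinearIsometryEquiv.neg ℝ (E := E)).norm_iteratedFDeriv_comp_right
    (fun z => f (y + z)) x k
  have hcomp : (fun z => f (y + z)) ∘ (LinearIsometryEquiv.neg ℝ (E := E)) =
      fun z => f (y - z) := by
    funext z
    simp [sub_eq_add_neg]
  rw [hcomp, iteratedFDeriv_comp_add_left] at h
  simpa [sub_eq_add_neg] using h

end Calculus

variable {d : ℕ}

section Convolution

theorem ext_of (f : Sp d → ℂ) (hf : ContDiff ℝ ∞ f) :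
    ext (Smooth.of (⊤ : Opens (Sp d)) f hf).1 = f :=
  funext fun x => ext_apply _ (Opens.mem_top x)

/-- The estimate `|⟨S, f⟩| ≤ C p_{K,l}(f)`, with `K` compact, that expresses the continuity of the
linear form `S` on `C^∞(ℝ^d)`. -/
structure CDistr.IsBoundedBy (S : CDistr d) (K : Set (Sp d)) (l : ℕ) (C : ℝ) : Prop where
  isCompact : IsCompact K
  nonneg : 0 ≤ C
  norm_toLin_le : ∀ f, ‖S.toLin f‖ ≤ C * seminorm K l f

theorem CDistr.exists_isBoundedBy (S : CDistr d) : ∃ K l C, S.IsBoundedBy K l C := by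
  obtain ⟨K, l, C, hK, hS⟩ := S.continuous'
  exact ⟨K, l, |C|, hK, abs_nonneg C, fun f =>
    (hS f).trans (mul_le_mul_of_nonneg_right (le_abs_self C) (seminorm_nonneg f))⟩

theorem CDistr.IsBoundedBy.norm_conv_le {S : CDistr d} {K : Set (Sp d)} {l : ℕ} {C : ℝ}
    (hS : S.IsBoundedBy K l C) {f : Sp d → ℂ} (hf : ContDiff ℝ ∞ f) {y : Sp d} {M : ℝ}
    (hM : 0 ≤ M) (hfM : ∀ k ≤ l, ∀ x ∈ K, ‖iteratedFDeriv ℝ k f (y - x)‖ ≤ M) :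
    ‖S.conv f hf y‖ ≤ C * M := by
  refine (hS.norm_toLin_le _).trans (mul_le_mul_of_nonneg_left ?_ hS.nonneg)
  refine seminorm_le hM fun k hk x hx => ?_
  rw [Smooth.flip, ext_of, norm_iteratedFDeriv_comp_sub_left]
  exact hfM k hk x hx

variable (S : CDistr d) {f g : Sp d → ℂ} (hf : ContDiff ℝ ∞ f) (hg : ContDiff ℝ ∞ g)

theorem CDistr.conv_congr (hfg : f = g) : S.conv f hf = S.conv g hg := by
  subst hfg
  rfl

theorem CDistr.conv_add (y : Sp d) :
    S.conv (fun x => f x + g x) (hf.add hg) y = S.conv f hf y + S.conv g hg y :=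
  S.toLin.map_add (Smooth.flip f hf y) (Smooth.flip g hg y)

theorem CDistr.conv_sub (y : Sp d) :
    S.conv (fun x => f x - g x) (hf.sub hg) y = S.conv f hf y - S.conv g hg y :=
  S.toLin.map_sub (Smooth.flip f hf y) (Smooth.flip g hg y)

theorem CDistr.conv_const_mul (c : ℂ) (y : Sp d) :
    S.conv (fun x => c * f x) (contDiff_const.mul hf) y = c * S.conv f hf y :=
  S.toLin.map_smul c (Smooth.flip f hf y)

theorem CDistr.conv_comp_add (h y : Sp d) :
    S.conv (fun x => f (x + h)) (hf.comp (contDiff_id.add contDiff_const)) y =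
      S.conv f hf (y + h) := by
  unfold CDistr.conv Smooth.flip
  congr 2
  funext x
  exact congrArg f (sub_add_eq_add_sub y x h)

/-- The differential `v ↦ (S ∗ ∂_v f)(y)` of `S ∗ f` at `y`. -/
noncomputable def CDistr.convDeriv (y : Sp d) : Sp d →L[ℝ] ℂ :=
  LinearMap.toContinuousLinearMap
    { toFun := fun v => S.conv (fun x => fderiv ℝ f x v) (contDiff_fderiv_apply_const hf v) y
      map_add' := fun v w => by
        rw [← S.conv_add]
        exact congrFun (S.conv_congr _ _ (funext fun x => map_add _ _ _)) y
      map_smul' := fun c v => by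
        rw [RingHom.id_apply, Complex.real_smul, ← S.conv_const_mul]
        exact congrFun (S.conv_congr _ _ (funext fun x => map_smul (fderiv ℝ f x) c v)) y }

theorem CDistr.hasFDerivAt_conv (y : Sp d) :
    HasFDerivAt (S.conv f hf) (S.convDeriv hf y) y := by
  obtain ⟨K, l, C, hS⟩ := S.exists_isBoundedBy
  have hC := hS.nonneg
  rw [hasFDerivAt_iff_isLittleO_nhds_zero, isLittleO_iff]
  intro c hc
  have hKy : IsCompact ((fun x => y - x) '' K) := hS.isCompact.image (by fun_prop)
  have hremainder : ∀ᶠ h in 𝓝 (0 : Sp d), ∀ k ∈ Set.Iic l, ∀ z ∈ (fun x => y - x) '' K,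
      ‖iteratedFDeriv ℝ k (fun x => f (x + h) - f x - fderiv ℝ f x h) z‖ ≤ c / (C + 1) * ‖h‖ :=
    (eventually_all_finite (Set.finite_Iic l)).2 fun k _ =>
      eventually_norm_iteratedFDeriv_remainder_le (hf.of_le (mod_cast le_top)) hKy (by positivity)
  filter_upwards [hremainder] with h hh
  have hshift : ContDiff ℝ ∞ fun x => f (x + h) := hf.comp (contDiff_id.add contDiff_const)
  have hdir := contDiff_fderiv_apply_const hf h
  calc ‖S.conv f hf (y + h) - S.conv f hf y - S.convDeriv hf y h‖
      = ‖S.conv (fun x => f (x + h) - f x - fderiv ℝ f x h) ((hshift.sub hf).sub hdir) y‖ := by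
        rw [S.conv_sub (hshift.sub hf) hdir, S.conv_sub hshift hf, S.conv_comp_add hf]
        rfl
    _ ≤ C * (c / (C + 1) * ‖h‖) :=
        hS.norm_conv_le _ (by positivity) fun k hk x hx => hh k hk _ ⟨x, hx, rfl⟩
    _ = C / (C + 1) * (c * ‖h‖) := by ring
    _ ≤ c * ‖h‖ := mul_le_of_le_one_left (by positivity)
        (div_le_one_of_le₀ (by linarith) (by positivity))

theorem CDistr.fderiv_conv_apply (v : Sp d) :
    (fun y => fderiv ℝ (S.conv f hf) y v) =
      S.conv (fun x => fderiv ℝ f x v) (contDiff_fderiv_apply_const hf v) := by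
  funext y
  rw [(S.hasFDerivAt_conv hf y).fderiv]
  rfl

theorem CDistr.contDiff_conv : ContDiff ℝ ∞ (S.conv f hf) := by
  rw [contDiff_infty]
  intro n
  induction n generalizing f with
  | zero =>
    exact contDiff_zero.2 (continuous_iff_continuousAt.2 fun y =>
      (S.hasFDerivAt_conv hf y).continuousAt)
  | succ n ih =>
    push_cast
    rw [contDiff_succ_iff_fderiv_apply]
    refine ⟨fun y => (S.hasFDerivAt_conv hf y).differentiableAt, by simp, fun v => ?_⟩
    rw [S.fderiv_conv_apply hf v]
    exact ih (contDiff_fderiv_apply_const hf v)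

variable {S} in
theorem CDistr.IsBoundedBy.norm_iteratedFDeriv_conv_le {K : Set (Sp d)} {l : ℕ} {C : ℝ}
    (hS : S.IsBoundedBy K l C) (n : ℕ) {y : Sp d} {M : ℝ} (hM : 0 ≤ M)
    (hfM : ∀ k ≤ l + n, ∀ x ∈ K, ‖iteratedFDeriv ℝ k f (y - x)‖ ≤ M) :
    ‖iteratedFDeriv ℝ n (S.conv f hf) y‖ ≤ C * M := by
  have hC := hS.nonneg
  induction n generalizing f M with
  | zero =>
    rw [norm_iteratedFDeriv_zero]
    exact hS.norm_conv_le hf hM hfM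
  | succ n ih =>
    refine ContinuousMultilinearMap.opNorm_le_bound (by positivity) fun m => ?_
    set v := m (Fin.last n)
    have hdir : ∀ k ≤ l + n, ∀ x ∈ K,
        ‖iteratedFDeriv ℝ k (fun z => fderiv ℝ f z v) (y - x)‖ ≤ ‖v‖ * M := fun k hk x hx =>
      (norm_iteratedFDeriv_fderiv_apply_const_le (hf.of_le (mod_cast le_top)) v _).trans
        (mul_le_mul_of_nonneg_left (hfM (k + 1) (by omega) x hx) (norm_nonneg v))
    rw [iteratedFDeriv_succ_apply_eq_fderiv_apply_last
      ((S.contDiff_conv hf).of_le (mod_cast le_top)), S.fderiv_conv_apply hf]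
    calc _ ≤ C * (‖v‖ * M) * ∏ i, ‖Fin.init m i‖ :=
          ContinuousMultilinearMap.le_of_opNorm_le
            (ih (contDiff_fderiv_apply_const hf v) (by positivity) hdir) _
      _ = C * M * ∏ i, ‖m i‖ := by
          rw [Fin.prod_univ_castSucc]
          simp only [Fin.init]
          ring

end Convolution

section Asymptotics

theorem exists_forall_isBigOWith_of_isBigO {α G : Type*} [SeminormedAddCommGroup G] {E : ℕ → Type*}
    [∀ k, Norm (E k)] {L : Filter α} {u : ∀ k, α → E k} {g : α → G} {n : ℕ}
    (h : ∀ k ≤ n, u k =O[L] g) : ∃ c, 0 ≤ c ∧ ∀ k ≤ n, IsBigOWith c L (u k) g :=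
  ((eventually_ge_atTop 0).and ((eventually_all_finite (Set.finite_Iic n)).2
    fun k hk => isBigO_iff_eventually_isBigOWith.1 (h k hk))).exists

variable {E A : Type*} [NormedAddCommGroup E] [NormedSpace ℝ E] [NormedRing A] [NormedAlgebra ℝ A]
  {L L' : Filter (Idx × E)} {f g : Idx → E → A}

/-- Moderateness along a filter `L` on the pairs `(ε, x)`: each derivative `D^k f_ε(x)` is
`O(ε^{-q})` along `L` for some `q`. For `L = ⊤` the estimates are uniform in all `ε` and `x`, for
`L = toZero ×ˢ 𝓟 K` they are uniform in `x ∈ K` as `ε → 0`. -/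
def ModerateAlong (L : Filter (Idx × E)) (f : Idx → E → A) : Prop :=
  ∀ l : ℕ, ∃ q : ℕ, ∀ k ≤ l,
    (fun p : Idx × E => iteratedFDeriv ℝ k (f p.1) p.2) =O[L] fun p => (p.1 : ℝ)⁻¹ ^ q

/-- Negligibility along a filter `L` on the pairs `(ε, x)`: each derivative `D^k f_ε(x)` is
`O(ε^p)` along `L` for all `p`. -/
def NegligibleAlong (L : Filter (Idx × E)) (f : Idx → E → A) : Prop :=
  ∀ k p : ℕ,
    (fun z : Idx × E => iteratedFDeriv ℝ k (f z.1) z.2) =O[L] fun z => (z.1 : ℝ) ^ p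

theorem ModerateAlong.mono (hf : ModerateAlong L' f) (hL : L ≤ L') : ModerateAlong L f := fun l =>
  (hf l).imp fun _ hq k hk => (hq k hk).mono hL

theorem NegligibleAlong.mono (hf : NegligibleAlong L' f) (hL : L ≤ L') : NegligibleAlong L f :=
  fun k p => (hf k p).mono hL

theorem NegligibleAlong.sup (hf : NegligibleAlong L f) (hf' : NegligibleAlong L' f) :
    NegligibleAlong (L ⊔ L') f := fun k p => (hf k p).sup (hf' k p)

theorem eventually_iteratedFDeriv_eq (hfg : ∀ᶠ p in L, f p.1 =ᶠ[𝓝 p.2] g p.1) (k : ℕ) :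
    (fun p : Idx × E => iteratedFDeriv ℝ k (f p.1) p.2) =ᶠ[L]
      fun p => iteratedFDeriv ℝ k (g p.1) p.2 :=
  hfg.mono fun _ hp => (hp.iteratedFDeriv ℝ k).eq_of_nhds

theorem ModerateAlong.congr (hf : ModerateAlong L f)
    (hfg : ∀ᶠ p in L, f p.1 =ᶠ[𝓝 p.2] g p.1) : ModerateAlong L g := fun l =>
  (hf l).imp fun _ hq k hk => (hq k hk).congr' (eventually_iteratedFDeriv_eq hfg k) .rfl

theorem NegligibleAlong.congr (hf : NegligibleAlong L f)
    (hfg : ∀ᶠ p in L, f p.1 =ᶠ[𝓝 p.2] g p.1) : NegligibleAlong L g := fun k p =>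
  (hf k p).congr' (eventually_iteratedFDeriv_eq hfg k) .rfl

theorem negligibleAlong_zero : NegligibleAlong L (0 : Idx → E → A) := fun k p =>
  (isBigO_zero _ L).congr_left fun _ => by simp

theorem NegligibleAlong.sub (hf : NegligibleAlong L f) (hg : NegligibleAlong L g)
    (hf' : ∀ ε, ContDiff ℝ ∞ (f ε)) (hg' : ∀ ε, ContDiff ℝ ∞ (g ε)) :
    NegligibleAlong L fun ε x => f ε x - g ε x := fun k p =>
  ((hf k p).sub (hg k p)).congr_left fun z =>
    (fun_iteratedFDeriv_sub_apply ((hf' z.1).of_le (mod_cast le_top)).contDiffAt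
      ((hg' z.1).of_le (mod_cast le_top)).contDiffAt).symm

theorem isBigO_iteratedFDeriv_mul (hf : ∀ ε, ContDiff ℝ ∞ (f ε)) (hg : ∀ ε, ContDiff ℝ ∞ (g ε))
    {k : ℕ} {a b : Idx × E → ℝ}
    (hfa : ∀ i ≤ k, (fun p : Idx × E => iteratedFDeriv ℝ i (f p.1) p.2) =O[L] a)
    (hgb : ∀ i ≤ k, (fun p : Idx × E => iteratedFDeriv ℝ i (g p.1) p.2) =O[L] b) :
    (fun p : Idx × E => iteratedFDeriv ℝ k (fun x => f p.1 x * g p.1 x) p.2) =O[L]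
      fun p => a p * b p := by
  have hleibniz : (fun p : Idx × E =>
      iteratedFDeriv ℝ k (fun x => f p.1 x * g p.1 x) p.2) =O[L]
      fun p => ∑ i ∈ Finset.range (k + 1), (k.choose i : ℝ) *
        ‖iteratedFDeriv ℝ i (f p.1) p.2‖ * ‖iteratedFDeriv ℝ (k - i) (g p.1) p.2‖ :=
    .of_norm_le fun p =>
      norm_iteratedFDeriv_mul_le (hf p.1) (hg p.1) p.2 (WithTop.coe_le_coe.2 le_top)
  refine hleibniz.trans (IsBigO.fun_sum fun i hi => ?_)
  exact ((hfa i (Finset.mem_range_succ_iff.1 hi)).norm_left.const_mul_left _).mul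
    (hgb _ (Nat.sub_le k i)).norm_left

theorem ModerateAlong.mul (hf : ModerateAlong L f) (hg : ModerateAlong L g)
    (hf' : ∀ ε, ContDiff ℝ ∞ (f ε)) (hg' : ∀ ε, ContDiff ℝ ∞ (g ε)) :
    ModerateAlong L fun ε x => f ε x * g ε x := fun l => by
  obtain ⟨q, hq⟩ := hf l
  obtain ⟨r, hr⟩ := hg l
  refine ⟨q + r, fun k hk => ?_⟩
  simpa only [pow_add] using isBigO_iteratedFDeriv_mul hf' hg' (fun i hi => hq i (hi.trans hk))
    fun i hi => hr i (hi.trans hk)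

theorem NegligibleAlong.mul_moderateAlong (hf : NegligibleAlong L f) (hg : ModerateAlong L g)
    (hf' : ∀ ε, ContDiff ℝ ∞ (f ε)) (hg' : ∀ ε, ContDiff ℝ ∞ (g ε)) :
    NegligibleAlong L fun ε x => f ε x * g ε x := fun k p => by
  obtain ⟨q, hq⟩ := hg k
  refine (isBigO_iteratedFDeriv_mul hf' hg' (fun i _ => hf i (p + q)) hq).congr_right fun z => ?_
  rw [pow_add, mul_assoc, ← mul_pow, mul_inv_cancel₀ z.1.2.1.ne', one_pow, mul_one]

theorem CDistr.IsBoundedBy.isBigO_iteratedFDeriv_conv {S : CDistr d} {K : Set (Sp d)} {l : ℕ}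
    {C : ℝ} (hS : S.IsBoundedBy K l C) {f : Idx → Sp d → ℂ} (hf : ∀ ε, ContDiff ℝ ∞ (f ε)) (n : ℕ)
    {g : Idx → ℝ} (hfg : ∀ k ≤ l + n,
      (fun p : Idx × Sp d => iteratedFDeriv ℝ k (f p.1) p.2) =O[⊤] fun p => g p.1) :
    (fun p : Idx × Sp d => iteratedFDeriv ℝ n (S.conv (f p.1) (hf p.1)) p.2) =O[⊤]
      fun p => g p.1 := by
  obtain ⟨c, hc, hb⟩ := exists_forall_isBigOWith_of_isBigO hfg
  refine isBigO_top.2 ⟨C * c, fun p => ?_⟩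
  rw [mul_assoc]
  exact hS.norm_iteratedFDeriv_conv_le _ n (by positivity)
    fun k hk x _ => isBigOWith_top.1 (hb k hk) (p.1, p.2 - x)

theorem ModerateAlong.conv {f : Idx → Sp d → ℂ} (h : ModerateAlong ⊤ f) (S : CDistr d)
    (hf : ∀ ε, ContDiff ℝ ∞ (f ε)) : ModerateAlong ⊤ fun ε => S.conv (f ε) (hf ε) := fun n => by
  obtain ⟨K, l, C, hS⟩ := S.exists_isBoundedBy
  obtain ⟨q, hq⟩ := h (l + n)
  exact ⟨q, fun k hk => hS.isBigO_iteratedFDeriv_conv hf k (g := fun ε => (ε : ℝ)⁻¹ ^ q)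
    fun j hj => hq j (by omega)⟩

theorem NegligibleAlong.conv {f : Idx → Sp d → ℂ} (h : NegligibleAlong ⊤ f) (S : CDistr d)
    (hf : ∀ ε, ContDiff ℝ ∞ (f ε)) : NegligibleAlong ⊤ fun ε => S.conv (f ε) (hf ε) :=
  fun n p => by
    obtain ⟨K, l, C, hS⟩ := S.exists_isBoundedBy
    exact hS.isBigO_iteratedFDeriv_conv hf n (g := fun ε => (ε : ℝ) ^ p) fun k _ => h k p

end Asymptotics

section Nets

theorem tendsto_coe_toZero : Tendsto (fun ε : Idx => (ε : ℝ)) toZero (𝓝[>] 0) :=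
  tendsto_nhdsWithin_iff.2 ⟨tendsto_comap, .of_forall fun ε => ε.2.1⟩

theorem isLittleO_coe_toZero : (fun ε : Idx => (ε : ℝ)) =o[toZero] fun _ => (1 : ℝ) :=
  (isLittleO_one_iff ℝ).2 tendsto_comap

theorem pow_succ_isLittleO_pow (p : ℕ) :
    (fun ε : Idx => (ε : ℝ) ^ (p + 1)) =o[toZero] fun ε => (ε : ℝ) ^ p := by
  simpa [pow_succ] using
    (isBigO_refl (fun ε : Idx => (ε : ℝ) ^ p) toZero).mul_isLittleO isLittleO_coe_toZero

theorem inv_pow_isLittleO_zpow (q : ℕ) :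
    (fun ε : Idx => (ε : ℝ)⁻¹ ^ q) =o[toZero] fun ε => (ε : ℝ) ^ (-((q + 1 : ℕ) : ℤ)) := by
  refine ((isBigO_refl (fun ε : Idx => (ε : ℝ)⁻¹ ^ (q + 1)) toZero).mul_isLittleO
    isLittleO_coe_toZero).congr (fun ε => ?_) fun ε => ?_
  · rw [pow_succ, mul_assoc, inv_mul_cancel₀ ε.2.1.ne', mul_one]
  · rw [mul_one, zpow_neg, zpow_natCast, inv_pow]

theorem isBigO_seminorm {f : Idx → Sp d → ℂ} (hf : ∀ ε, ContDiff ℝ ∞ (f ε)) {K : Set (Sp d)}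
    {l : ℕ} {g : Idx → ℝ} (hfg : ∀ k ≤ l, (fun p : Idx × Sp d => iteratedFDeriv ℝ k (f p.1) p.2)
      =O[toZero ×ˢ 𝓟 K] fun p => g p.1) :
    (fun ε => seminorm K l (Smooth.of ⊤ (f ε) (hf ε))) =O[toZero] g := by
  obtain ⟨c, hc, hb⟩ := exists_forall_isBigOWith_of_isBigO hfg
  have hK : ∀ᶠ ε in toZero, ∀ k ∈ Set.Iic l, ∀ x ∈ K,
      ‖iteratedFDeriv ℝ k (f ε) x‖ ≤ c * ‖g ε‖ :=
    (eventually_all_finite (Set.finite_Iic l)).2 fun k hk =>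
      eventually_prod_principal_iff.1 (isBigOWith_iff.1 (hb k hk))
  refine .of_bound c (hK.mono fun ε hε => ?_)
  rw [Real.norm_of_nonneg (seminorm_nonneg _)]
  refine seminorm_le (by positivity) fun k hk x hx => ?_
  rw [ext_of]
  exact hε k hk x hx

theorem isModerate_of_moderateAlong {f : Idx → Sp d → ℂ} (hf : ∀ ε, ContDiff ℝ ∞ (f ε))
    (h : ∀ K, IsCompact K → ModerateAlong (toZero ×ˢ 𝓟 K) f) : IsModerate f := by
  refine ⟨hf, fun l K hK _ => ?_⟩
  obtain ⟨q, hq⟩ := h K hK l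
  exact ⟨q + 1, (isBigO_seminorm hf (g := fun ε => (ε : ℝ)⁻¹ ^ q) hq).trans_isLittleO
    (inv_pow_isLittleO_zpow q)⟩

theorem G.restrict_classOf_eq {f g : Idx → Sp d → ℂ} (hf : IsModerate f) (hg : IsModerate g)
    {Ω : Opens (Sp d)} (h : ∀ K, IsCompact K → K ⊆ Ω →
      NegligibleAlong (toZero ×ˢ 𝓟 K) fun ε x => f ε x - g ε x) :
    G.restrict (le_top : Ω ≤ ⊤) (classOf f hf) = G.restrict le_top (classOf g hg) := by
  refine Ideal.Quotient.eq.2 fun l K hK hKΩ p => ?_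
  have hsub : ∀ ε, ContDiff ℝ ∞ fun x => f ε x - g ε x := fun ε => (hf.fst ε).sub (hg.fst ε)
  change (fun ε => seminorm K l ((Smooth.of ⊤ _ (hsub ε)).restrict (le_top : Ω ≤ ⊤))) =o[toZero] _
  simp only [seminorm_restrict _ hKΩ]
  exact (isBigO_seminorm hsub (g := fun ε => (ε : ℝ) ^ (p + 1))
    fun k _ => h K hK hKΩ k (p + 1)).trans_isLittleO (pow_succ_isLittleO_pow p)

theorem seminorm_biUnion_le {Ω : Opens (Sp d)} {ι : Type*} {t : Finset ι} {K : ι → Set (Sp d)}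
    (hK : ∀ i ∈ t, IsCompact (K i)) (hKΩ : ∀ i ∈ t, K i ⊆ Ω) (l : ℕ) (f : Smooth Ω) :
    seminorm (⋃ i ∈ t, K i) l f ≤ ∑ i ∈ t, seminorm (K i) l f := by
  refine seminorm_le (Finset.sum_nonneg fun _ _ => seminorm_nonneg f) fun k hk x hx => ?_
  obtain ⟨i, hi, hxi⟩ := mem_iUnion₂.1 hx
  exact (le_seminorm (hK i hi) (hKΩ i hi) f hk hxi).trans
    (Finset.single_le_sum (f := fun i => seminorm (K i) l f) (fun _ _ => seminorm_nonneg f) hi)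

theorem G.eq_of_restrict_eq {Λ : Type*} {Ω : Λ → Opens (Sp d)}
    (hΩ : ⋃ i, (Ω i : Set (Sp d)) = Set.univ) {u v : G (⊤ : Opens (Sp d))}
    (h : ∀ i, G.restrict (le_top : Ω i ≤ ⊤) u = G.restrict le_top v) : u = v := by
  obtain ⟨f, rfl⟩ := Ideal.Quotient.mk_surjective u
  obtain ⟨g, rfl⟩ := Ideal.Quotient.mk_surjective v
  refine Ideal.Quotient.eq.2 fun l K hK _ p => ?_
  obtain ⟨t, ht⟩ := hK.elim_finite_subcover (fun i => (Ω i : Set (Sp d)))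
    (fun i => (Ω i).isOpen) (hΩ ▸ subset_univ K)
  obtain ⟨K', hK', hK'Ω, rfl⟩ := hK.finite_compact_cover t (fun i => (Ω i : Set (Sp d)))
    (fun i _ => (Ω i).isOpen) ht
  have hlocal : ∀ i ∈ t, (fun ε => seminorm (K' i) l ((f - g).1 ε)) =o[toZero]
      fun ε => (ε : ℝ) ^ p := fun i _ => by
    have hi := Ideal.Quotient.eq.1 (h i) l (K' i) (hK' i) (hK'Ω i) p
    change (fun ε => seminorm (K' i) l
      (((f - g).1 ε).restrict (le_top : Ω i ≤ ⊤))) =o[toZero] _ at hi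
    simpa only [seminorm_restrict _ (hK'Ω i)] using hi
  refine (IsBigO.of_norm_le fun ε => ?_).trans_isLittleO (IsLittleO.fun_sum hlocal)
  rw [Real.norm_of_nonneg (seminorm_nonneg _)]
  exact seminorm_biUnion_le (fun i _ => hK' i) (fun _ _ => subset_univ _) l _

end Nets

section Mollifiers

theorem one_le_inv_coe (ε : Idx) : 1 ≤ (ε : ℝ)⁻¹ := (one_le_inv₀ ε.2.1).2 ε.2.2

theorem abs_log_le_inv (ε : Idx) : |Real.log ε| ≤ (ε : ℝ)⁻¹ := by
  have h := Real.abs_log_mul_self_lt ε ε.2.1 ε.2.2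
  rw [abs_mul, abs_of_pos ε.2.1] at h
  rw [← one_div, le_div_iff₀ ε.2.1]
  exact h.le

theorem abs_log_sq_mul_le (ε : Idx) : |Real.log ε| ^ 2 * ε ≤ 4 := by
  have h := Real.abs_log_mul_self_lt √ε (Real.sqrt_pos.2 ε.2.1) (Real.sqrt_le_one.2 ε.2.2)
  have hsq := (sq_lt_one_iff_abs_lt_one _).2 h
  rw [Real.log_sqrt ε.2.1.le, mul_pow, Real.sq_sqrt ε.2.1.le] at hsq
  rw [sq_abs]
  linarith

variable (ρ : 𝓢(Sp d, ℂ)) (χ : 𝓓((⊤ : Opens (Sp d)), ℝ))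

theorem norm_iteratedFDeriv_rhoEps (ε : Idx) (k : ℕ) (x : Sp d) :
    ‖iteratedFDeriv ℝ k (rhoEps ρ ε) x‖ =
      (ε : ℝ)⁻¹ ^ (d + k) * ‖iteratedFDeriv ℝ k ρ ((ε : ℝ)⁻¹ • x)‖ := by
  have hε : (0 : ℝ) < ε := ε.2.1
  have hρ : ContDiff ℝ k ρ := ρ.smooth k
  have hsmul : rhoEps ρ ε = fun x => ((ε : ℝ) ^ d)⁻¹ • ρ ((ε : ℝ)⁻¹ • x) := by
    funext x
    rw [Complex.real_smul]
    rfl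
  have hscale : ContDiff ℝ k fun x => ρ ((ε : ℝ)⁻¹ • x) := hρ.comp (contDiff_const_smul _)
  rw [hsmul, iteratedFDeriv_const_smul_apply' hscale.contDiffAt,
    iteratedFDeriv_comp_const_smul _ hρ, norm_smul, norm_smul, Real.norm_of_nonneg (by positivity),
    Real.norm_of_nonneg (by positivity), pow_add, inv_pow, inv_pow, mul_assoc]

theorem exists_pow_mul_norm_iteratedFDeriv_rhoEps_le (N k : ℕ) :
    ∃ C, 0 < C ∧ ∀ (ε : Idx) (x : Sp d), ‖x‖ ^ N * ‖iteratedFDeriv ℝ k (rhoEps ρ ε) x‖ ≤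
      C * ((ε : ℝ) ^ N * (ε : ℝ)⁻¹ ^ (d + k)) := by
  obtain ⟨C, hC, hdecay⟩ := ρ.decay N k
  refine ⟨C, hC, fun ε x => ?_⟩
  have hε : (0 : ℝ) < ε := ε.2.1
  have hx : ‖x‖ ^ N = (ε : ℝ) ^ N * ‖(ε : ℝ)⁻¹ • x‖ ^ N := by
    rw [← mul_pow, norm_smul, norm_inv, Real.norm_of_nonneg hε.le, mul_inv_cancel_left₀ hε.ne']
  calc ‖x‖ ^ N * ‖iteratedFDeriv ℝ k (rhoEps ρ ε) x‖
      = (‖(ε : ℝ)⁻¹ • x‖ ^ N * ‖iteratedFDeriv ℝ k ρ ((ε : ℝ)⁻¹ • x)‖) *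
          ((ε : ℝ) ^ N * (ε : ℝ)⁻¹ ^ (d + k)) := by
        rw [norm_iteratedFDeriv_rhoEps, hx]
        ring
    _ ≤ C * ((ε : ℝ) ^ N * (ε : ℝ)⁻¹ ^ (d + k)) := by
        gcongr
        exact hdecay _

theorem moderateAlong_rhoEps : ModerateAlong ⊤ (rhoEps ρ) := fun l => by
  refine ⟨d + l, fun k hk => ?_⟩
  obtain ⟨C, hC, hρ⟩ := exists_pow_mul_norm_iteratedFDeriv_rhoEps_le ρ 0 k
  refine isBigO_top.2 ⟨C, fun p => ?_⟩
  have hp : (0 : ℝ) < p.1 := p.1.2.1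
  calc ‖iteratedFDeriv ℝ k (rhoEps ρ p.1) p.2‖ ≤ C * (p.1 : ℝ)⁻¹ ^ (d + k) := by
        simpa using hρ p.1 p.2
    _ ≤ C * ‖(p.1 : ℝ)⁻¹ ^ (d + l)‖ := by
        rw [Real.norm_of_nonneg (by positivity)]
        gcongr
        exact one_le_inv_coe p.1

/- The decay of `ρ` yields the factor `(ε / |x|)^{2m}`, which for `r ≤ |ln ε| |x|` is at most
`(ε |ln ε| / r)^{2m}`, hence a multiple of `ε^m` as `ε |ln ε|²` is bounded. -/
theorem negligibleAlong_rhoEps {r : ℝ} (hr : 0 < r) :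
    NegligibleAlong (𝓟 {p : Idx × Sp d | r ≤ |Real.log p.1| * ‖p.2‖}) (rhoEps ρ) := fun k p => by
  set m := p + (d + k) with hm
  obtain ⟨C, hC, hρ⟩ := exists_pow_mul_norm_iteratedFDeriv_rhoEps_le ρ (2 * m) k
  refine isBigO_principal.2 ⟨(r ^ (2 * m))⁻¹ * (C * 4 ^ m), fun ⟨ε, x⟩ hx => ?_⟩
  have hε : (0 : ℝ) < ε := ε.2.1
  have hcancel : (ε : ℝ) ^ m * (ε : ℝ)⁻¹ ^ (d + k) = (ε : ℝ) ^ p := by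
    rw [hm, pow_add, mul_assoc, ← mul_pow, mul_inv_cancel₀ hε.ne', one_pow, mul_one]
  rw [Real.norm_of_nonneg (by positivity), mul_assoc, le_inv_mul_iff₀ (by positivity)]
  calc r ^ (2 * m) * ‖iteratedFDeriv ℝ k (rhoEps ρ ε) x‖
      ≤ (|Real.log ε| * ‖x‖) ^ (2 * m) * ‖iteratedFDeriv ℝ k (rhoEps ρ ε) x‖ := by
        gcongr
        exact hx
    _ = |Real.log ε| ^ (2 * m) * (‖x‖ ^ (2 * m) * ‖iteratedFDeriv ℝ k (rhoEps ρ ε) x‖) := by ring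
    _ ≤ |Real.log ε| ^ (2 * m) * (C * ((ε : ℝ) ^ (2 * m) * (ε : ℝ)⁻¹ ^ (d + k))) :=
        mul_le_mul_of_nonneg_left (hρ ε x) (by positivity)
    _ = C * (|Real.log ε| ^ 2 * ε) ^ m * ((ε : ℝ) ^ m * (ε : ℝ)⁻¹ ^ (d + k)) := by ring
    _ ≤ C * 4 ^ m * (ε : ℝ) ^ p := by
        rw [hcancel]
        gcongr
        exact abs_log_sq_mul_le ε

/-- The scaled cutoff `x ↦ χ (x |ln ε|)`. -/
noncomputable def chiEps (ε : Idx) (x : Sp d) : ℂ := (χ (|Real.log ε| • x) : ℂ)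

theorem contDiff_chiEps (ε : Idx) : ContDiff ℝ ∞ (chiEps χ ε) :=
  Complex.ofRealCLM.contDiff.comp (χ.contDiff.comp (contDiff_const_smul _))

theorem moderateAlong_chiEps : ModerateAlong ⊤ (chiEps χ) := fun l => by
  refine ⟨l, fun k hk => ?_⟩
  have hsmooth : ContDiff ℝ k fun x => (χ x : ℂ) :=
    Complex.ofRealCLM.contDiff.comp (χ.contDiff.of_le (mod_cast le_top))
  have hsupp : HasCompactSupport fun x => (χ x : ℂ) :=
    χ.hasCompactSupport.comp_left (g := fun r : ℝ => (r : ℂ)) Complex.ofReal_zero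
  obtain ⟨C, hC⟩ := (hsupp.iteratedFDeriv (𝕜 := ℝ) k).exists_bound_of_continuous
    (hsmooth.continuous_iteratedFDeriv le_rfl)
  refine isBigO_top.2 ⟨C, fun ⟨ε, x⟩ => ?_⟩
  have hε : (0 : ℝ) < ε := ε.2.1
  have hlog : |Real.log ε| ^ k ≤ (ε : ℝ)⁻¹ ^ l :=
    (pow_le_pow_left₀ (abs_nonneg _) (abs_log_le_inv ε) k).trans
      (pow_le_pow_right₀ (one_le_inv_coe ε) hk)
  have hscale : iteratedFDeriv ℝ k (chiEps χ ε) x =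
      |Real.log ε| ^ k • iteratedFDeriv ℝ k (fun x => (χ x : ℂ)) (|Real.log ε| • x) :=
    congrFun (iteratedFDeriv_comp_const_smul |Real.log ε| hsmooth) x
  calc ‖iteratedFDeriv ℝ k (chiEps χ ε) x‖
      = ‖iteratedFDeriv ℝ k (fun x => (χ x : ℂ)) (|Real.log ε| • x)‖ * |Real.log ε| ^ k := by
        rw [hscale, norm_smul, norm_pow, Real.norm_eq_abs, abs_abs, mul_comm]
    _ ≤ C * ‖(ε : ℝ)⁻¹ ^ l‖ := by
        rw [Real.norm_of_nonneg (by positivity)]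
        exact mul_le_mul (hC _) hlog (by positivity) ((norm_nonneg _).trans (hC 0))

/-- The function `θ_ε(x) = ρ_ε(x) χ(x |ln ε|)`. Unlike the test function `thetaEps`, it is defined
for `ε = 1` too, so that the `θ_ε` form a net indexed by `(0,1]`. -/
noncomputable def thetaFun (ε : Idx) (x : Sp d) : ℂ := rhoEps ρ ε x * chiEps χ ε x

theorem contDiff_thetaFun (ε : Idx) : ContDiff ℝ ∞ (thetaFun ρ χ ε) :=
  (contDiff_rhoEps ρ ε).mul (contDiff_chiEps χ ε)

theorem moderateAlong_thetaFun : ModerateAlong ⊤ (thetaFun ρ χ) :=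
  (moderateAlong_rhoEps ρ).mul (moderateAlong_chiEps χ) (contDiff_rhoEps ρ) (contDiff_chiEps χ)

variable {χ} in
theorem negligibleAlong_rhoEps_sub_thetaFun (hχ : ∀ᶠ x in 𝓝 0, χ x = 1) :
    NegligibleAlong ⊤ fun ε x => rhoEps ρ ε x - thetaFun ρ χ ε x := by
  obtain ⟨r, hr, hχr⟩ := Metric.eventually_nhds_iff.1 hχ
  set far : Set (Idx × Sp d) := {p | r ≤ |Real.log p.1| * ‖p.2‖}
  have hfar : NegligibleAlong (𝓟 far) fun ε x => rhoEps ρ ε x - thetaFun ρ χ ε x :=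
    (negligibleAlong_rhoEps ρ hr).sub ((negligibleAlong_rhoEps ρ hr).mul_moderateAlong
      ((moderateAlong_chiEps χ).mono le_top) (contDiff_rhoEps ρ) (contDiff_chiEps χ))
      (contDiff_rhoEps ρ) (contDiff_thetaFun ρ χ)
  have hnear : NegligibleAlong (𝓟 farᶜ) fun ε x => rhoEps ρ ε x - thetaFun ρ χ ε x := by
    refine negligibleAlong_zero.congr (eventually_principal.2 fun ⟨ε, x⟩ hx => ?_)
    have hopen : IsOpen {z : Sp d | |Real.log ε| * ‖z‖ < r} := isOpen_lt (by fun_prop) (by fun_prop)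
    filter_upwards [hopen.mem_nhds (not_le.1 (notMem_ofPred_iff.1 hx))] with z hz
    have hone : χ (|Real.log ε| • z) = 1 := hχr (by simpa [norm_smul] using hz)
    simp [thetaFun, chiEps, hone]
  simpa using hfar.sup hnear

end Mollifiers

section Localization

theorem exists_testFunction_eq_one {E : Type*} [NormedAddCommGroup E] [NormedSpace ℝ E]
    [FiniteDimensional ℝ E] {s : Set E} (hs : Bornology.IsBounded s) :
    ∃ ψ : 𝓓((⊤ : Opens E), ℝ), ∀ x ∈ s, ψ x = 1 := by
  obtain ⟨R, hR, hsR⟩ := hs.exists_pos_norm_le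
  let bump : ContDiffBump (0 : E) := ⟨R, R + 1, hR, lt_add_one R⟩
  exact ⟨⟨bump, bump.contDiff, bump.hasCompactSupport, fun _ _ => trivial⟩, fun x hx =>
    bump.one_of_mem_closedBall (mem_closedBall_zero_iff.2 (hsR x hx))⟩

theorem Distr.conv_eq_cut_conv (T : Distr d) {ψ : 𝓓((⊤ : Opens (Sp d)), ℝ)} {φ : Test d}
    {y : Sp d} (h : ∀ x, φ (y - x) ≠ 0 → ψ x = 1) :
    T.conv φ y = (T.cut ψ).conv φ φ.contDiff y := by
  change T (φ.flip y) = T (mulTest ψ (Smooth.flip φ φ.contDiff y))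
  congr 1
  ext x
  change φ (y - x) = (ψ x : ℂ) * φ (y - x)
  rcases eq_or_ne (φ (y - x)) 0 with hx | hx
  · rw [hx, mul_zero]
  · rw [h x hx, Complex.ofReal_one, one_mul]

theorem tendsto_abs_log_toZero : Tendsto (fun ε : Idx => |Real.log ε|) toZero atTop :=
  tendsto_abs_atBot_atTop.comp (Real.tendsto_log_nhdsGT_zero.comp tendsto_coe_toZero)

variable (ρ : 𝓢(Sp d, ℂ)) (χ ψ : 𝓓((⊤ : Opens (Sp d)), ℝ)) (T : Distr d)

variable {χ ψ} in
theorem netS_eq_cut_conv {R : ℝ} (hR : ∀ x ∈ tsupport χ, ‖x‖ ≤ R) {ε : Idx} (hε : (ε : ℝ) < 1)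
    {y : Sp d} (hψ : ∀ x ∈ Metric.closedBall y (R / |Real.log ε|), ψ x = 1) :
    netS ρ χ T ε y = (T.cut ψ).conv (thetaFun ρ χ ε) (contDiff_thetaFun ρ χ ε) y := by
  rw [netS, dif_pos hε]
  refine T.conv_eq_cut_conv fun x hx => hψ x ?_
  have hlog : 0 < |Real.log ε| := abs_pos.2 (Real.log_neg ε.2.1 hε).ne
  have hχ : χ (|Real.log ε| • (y - x)) ≠ 0 := fun h =>
    hx (mul_eq_zero_of_right _ (Complex.ofReal_eq_zero.2 h))
  have hnorm := hR _ (subset_tsupport _ hχ)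
  rwa [norm_smul, Real.norm_eq_abs, abs_abs, ← dist_eq_norm', ← le_div_iff₀' hlog] at hnorm

variable {χ ψ} in
theorem netS_eventuallyEq_cut_conv {R : ℝ} (hR : ∀ x ∈ tsupport χ, ‖x‖ ≤ R) {ε : Idx}
    (hε : (ε : ℝ) < 1) {y : Sp d} {r : ℝ} (hr : R / |Real.log ε| < r)
    (hψ : ∀ x ∈ Metric.closedBall y r, ψ x = 1) :
    netS ρ χ T ε =ᶠ[𝓝 y] (T.cut ψ).conv (thetaFun ρ χ ε) (contDiff_thetaFun ρ χ ε) := by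
  filter_upwards [Metric.closedBall_mem_nhds y (sub_pos.2 hr)] with z hz
  refine netS_eq_cut_conv ρ T hR hε fun x hx => hψ x ?_
  exact Metric.closedBall_subset_closedBall' (by linarith [Metric.mem_closedBall.1 hz]) hx

theorem contDiff_netS (ε : Idx) : ContDiff ℝ ∞ (netS ρ χ T ε) := by
  by_cases hε : (ε : ℝ) < 1
  · obtain ⟨R, hR⟩ := χ.hasCompactSupport.isBounded.exists_norm_le
    refine contDiff_iff_contDiffAt.2 fun y => ?_
    obtain ⟨ψ, hψ⟩ := exists_testFunction_eq_one
      (Metric.isBounded_closedBall (x := y) (r := R / |Real.log ε| + 1))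
    exact ((T.cut ψ).contDiff_conv (contDiff_thetaFun ρ χ ε)).contDiffAt.congr_of_eventuallyEq
      (netS_eventuallyEq_cut_conv ρ T hR hε (lt_add_one _) hψ)
  · rw [netS, dif_neg hε]
    exact contDiff_const

variable {ψ} in
theorem eventually_cut_conv_eventuallyEq_netS {K U : Set (Sp d)} (hK : IsCompact K)
    (hU : IsOpen U) (hKU : K ⊆ U) (hψ : ∀ x ∈ U, ψ x = 1) :
    ∀ᶠ p in toZero ×ˢ 𝓟 K, (T.cut ψ).conv (thetaFun ρ χ p.1) (contDiff_thetaFun ρ χ p.1)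
      =ᶠ[𝓝 p.2] netS ρ χ T p.1 := by
  obtain ⟨R, hR⟩ := χ.hasCompactSupport.isBounded.exists_norm_le
  obtain ⟨δ, hδ, hδU⟩ := hK.exists_cthickening_subset_open hU hKU
  have hlt : ∀ᶠ ε : Idx in toZero, (ε : ℝ) < 1 := tendsto_comap.eventually_lt_const one_pos
  have hradius : ∀ᶠ ε : Idx in toZero, R / |Real.log ε| < δ :=
    (tendsto_abs_log_toZero.const_div_atTop R).eventually_lt_const hδ
  refine eventually_prod_principal_iff.2 ?_
  filter_upwards [hlt, hradius] with ε hε hr y hy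
  exact (netS_eventuallyEq_cut_conv ρ T hR hε hr fun x hx =>
    hψ x (hδU (Metric.closedBall_subset_cthickening hy δ hx))).symm

end Localization

section Embeddings

theorem isModerate_netZero (ρ : 𝓢(Sp d, ℂ)) (S : CDistr d) : IsModerate (netZero ρ S) :=
  isModerate_of_moderateAlong (fun ε => S.contDiff_conv (contDiff_rhoEps ρ ε)) fun _ _ =>
    ((moderateAlong_rhoEps ρ).conv S (contDiff_rhoEps ρ)).mono le_top

theorem isModerate_netS (ρ : 𝓢(Sp d, ℂ)) (χ : 𝓓((⊤ : Opens (Sp d)), ℝ)) (T : Distr d) :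
    IsModerate (netS ρ χ T) := by
  refine isModerate_of_moderateAlong (contDiff_netS ρ χ T) fun K hK => ?_
  obtain ⟨ψ, hψ⟩ := exists_testFunction_eq_one (hK.isBounded.thickening (δ := 1))
  exact (((moderateAlong_thetaFun ρ χ).conv (T.cut ψ) (contDiff_thetaFun ρ χ)).mono le_top).congr
    (eventually_cut_conv_eventuallyEq_netS ρ χ T hK Metric.isOpen_thickening
      (Metric.self_subset_thickening one_pos K) hψ)

theorem isGluing_iotaS (ρ : 𝓢(Sp d, ℂ)) {χ : 𝓓((⊤ : Opens (Sp d)), ℝ)}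
    (hχ : ∀ᶠ x in 𝓝 0, χ x = 1) {Λ : Type*} {Ω : Λ → Opens (Sp d)}
    {ψ : Λ → 𝓓((⊤ : Opens (Sp d)), ℝ)} (hψ : ∀ i, ∀ x ∈ Ω i, ψ i x = 1) :
    IsGluing ρ (isModerate_netZero ρ) Ω ψ (iotaS ρ χ (isModerate_netS ρ χ)) := by
  refine fun i T => (G.restrict_classOf_eq (isModerate_netZero ρ _) (isModerate_netS ρ χ T)
    fun K hK hKΩ => ?_).symm
  have hρθ : ∀ ε, ContDiff ℝ ∞ fun x => rhoEps ρ ε x - thetaFun ρ χ ε x := fun ε =>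
    (contDiff_rhoEps ρ ε).sub (contDiff_thetaFun ρ χ ε)
  refine (((negligibleAlong_rhoEps_sub_thetaFun ρ hχ).conv (T.cut (ψ i)) hρθ).mono le_top).congr ?_
  filter_upwards [eventually_cut_conv_eventuallyEq_netS ρ χ T hK (Ω i).isOpen hKΩ (hψ i)]
    with p hp
  filter_upwards [hp] with y hy
  rw [CDistr.conv_sub _ (contDiff_rhoEps ρ p.1) (contDiff_thetaFun ρ χ p.1), hy]
  rfl

end Embeddings

end Colombeau

open Colombeau in
theorem mainTheorem2_general {d : ℕ} (ρ : 𝓢(Sp d, ℂ)) (χ : 𝓓((⊤ : Opens (Sp d)), ℝ))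
    (hχ : ∀ᶠ x in 𝓝 0, χ x = 1) {Λ : Type*} (Ω : Λ → Opens (Sp d))
    (hΩ : ⋃ i, (Ω i : Set (Sp d)) = Set.univ) (ψ : Λ → 𝓓((⊤ : Opens (Sp d)), ℝ))
    (hψ : ∀ i, ∀ x ∈ Ω i, ψ i x = 1) :
    ∃ (hZero : ∀ S : CDistr d, IsModerate (netZero ρ S))
      (hS : ∀ T : Distr d, IsModerate (netS ρ χ T)),
      (∃! ι : Distr d → G (⊤ : Opens (Sp d)), IsGluing ρ hZero Ω ψ ι) ∧
      ∀ ιA : Distr d → G (⊤ : Opens (Sp d)), IsGluing ρ hZero Ω ψ ιA → ιA = iotaS ρ χ hS := by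
  have hglue := isGluing_iotaS ρ hχ hψ
  have hunique : ∀ ιA, IsGluing ρ (isModerate_netZero ρ) Ω ψ ιA →
      ιA = iotaS ρ χ (isModerate_netS ρ χ) := fun ιA hA =>
    funext fun T => G.eq_of_restrict_eq hΩ fun i => (hA i T).trans (hglue i T).symm
  exact ⟨isModerate_netZero ρ, isModerate_netS ρ χ, ⟨_, hglue, hunique⟩, hunique⟩

theorem mainTheorem2 {d : ℕ} (ρ : 𝓢(Colombeau.Sp d, ℂ)) (hρ : Colombeau.IsMollifier ρ)
    (χ : 𝓓((⊤ : Opens (Colombeau.Sp d)), ℝ)) (hχ : Colombeau.IsCutoff χ)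
    {Λ : Type*} (Ω : Λ → Opens (Colombeau.Sp d)) (ψ : Λ → 𝓓((⊤ : Opens (Colombeau.Sp d)), ℝ))
    (hΩψ : Colombeau.IsCutoffCover Ω ψ) :
    ∃ (hZero : ∀ S : Colombeau.CDistr d, Colombeau.IsModerate (Colombeau.netZero ρ S))
      (hS : ∀ T : Colombeau.Distr d, Colombeau.IsModerate (Colombeau.netS ρ χ T)),
      (∃! ι : Colombeau.Distr d → Colombeau.G (⊤ : Opens (Colombeau.Sp d)),
        Colombeau.IsGluing ρ hZero Ω ψ ι) ∧
      ∀ ιA : Colombeau.Distr d → Colombeau.G (⊤ : Opens (Colombeau.Sp d)),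
        Colombeau.IsGluing ρ hZero Ω ψ ιA → ιA = Colombeau.iotaS ρ χ hS := by
  exact mainTheorem2_general ρ χ (Filter.eventually_of_mem (Metric.closedBall_mem_nhds _ one_pos)
    hχ.eq_one) Ω hΩψ.cover ψ fun i x hx => (hΩψ.eq_one i).self_of_nhdsSet x (subset_closure hx)
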